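/- Let $X$ be a real locally convex Hausdorff topological vector space with dual $X^*$. Let $\Gamma(X)$ be the class of proper lower semicontinuous convex functions $h:X\to\mathbb{R}\cup\{+\infty\}$; write $\operatorname{dom}h=\{x: h(x)<+\infty\}$ and $[h\le r]=\{x:h(x)\le r\}$. The recession function $h_\infty$ of $h\in\Gamma(X)$ is the function whose epigraph is the recession cone $\{d:\operatorname{epi}h+\mathbb{R}_+d\subset\operatorname{epi}h\}$ of $\operatorname{epi}h$. A function $h$ is weakly inf-locally compact if $[h\le r]$ is locally compact for the weak topology $\sigma(X,X^*)$ for every $r\in\mathbb{R}$. Let $f\in\Gamma(X)$ and $f_t\in\Gamma(X)$ for $t\in T$, let $E=\bigcap_{t\in T}[f_t\le 0]$, and consider the problem $$(\mathrm{P})\qquad \inf\{f(x): x\in X,\ f_t(x)\le 0\ \ \forall t\in T\},$$ where $E\cap\operatorname{dom}f\neq\emptyset$. Put $(\mathrm{P})_\infty=\bigcap_{t\in T}[(f_t)_\infty\le 0]\cap[f_\infty\le 0]$, and use the convention $0\cdot(+\infty)=0$. Assume that (a) $\operatorname{dom}f\subset\bigcap_{t\in T}\operatorname{dom}f_t$;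 (b) $T$ is a convex and compact subset of some (real) locally convex topological vector space; (c) for each $x\in\bigcap_{t\in T}\operatorname{dom}f_t$ the function $t\mapsto f_t(x)$ is concave and upper semicontinuous on $T$; (d) there exists $(\bar t,\bar\mu)\in T\times\mathbb{R}_+$ such that $f+\bar\mu f_{\bar t}$ is weakly inf-locally compact; (e) $(\mathrm{P})_\infty$ is a linear subspace of $X$. Then $(\mathrm{P})$ attains its infimum, and $$\min(\mathrm{P})=\sup_{(t,\mu)\in T\times\mathbb{R}_+}\ \inf_{x\in X}\{f(x)+\mu f_t(x)\}\in\mathbb{R}.$$ -/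

import Mathlib

open scoped NNReal

namespace ReverseDuality

/-- The epigraph of `h : X → [-∞, +∞]`, as a subset of `X × ℝ`. -/
def epi {X : Type*} (h : X → EReal) : Set (X × ℝ) :=
  {p | h p.1 ≤ (p.2 : EReal)}

/-- The effective domain of `h`. -/
def effDom {X : Type*} (h : X → EReal) : Set X :=
  {x | h x < ⊤}

/-- `h` is proper: its epigraph is non-empty and it never takes the value `-∞`. -/
def IsProper {X : Type*} (h : X → EReal) : Prop :=
  (epi h).Nonempty ∧ ∀ x, h x ≠ ⊥

/-- `h` belongs to `Γ(X)`: it is proper, convex (convex epigraph) and lower semicontinuous. -/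
structure IsGamma {X : Type*} [AddCommGroup X] [Module ℝ X] [TopologicalSpace X]
    (h : X → EReal) : Prop where
  proper : IsProper h
  convex : Convex ℝ (epi h)
  lsc : LowerSemicontinuous h

/-- `φ : Z → [-∞, +∞]` is concave on the set `T`: the hypograph of its restriction to `T`
is convex. -/
def IsConcaveOn {Z : Type*} [AddCommGroup Z] [Module ℝ Z] (T : Set Z) (φ : Z → EReal) : Prop :=
  Convex ℝ {p : Z × ℝ | p.1 ∈ T ∧ (p.2 : EReal) ≤ φ p.1}

/-- The recession cone `A_∞` of a (closed convex) set `A`: the directions `d` with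
`A + ℝ₊ d ⊆ A`. -/
def recessionCone {V : Type*} [AddCommGroup V] [Module ℝ V] (A : Set V) : Set V :=
  {d | ∀ a ∈ A, ∀ s : ℝ, 0 ≤ s → a + s • d ∈ A}

/-- The recession function `h_∞` of `h`, i.e. the function whose epigraph is the recession cone
of the epigraph of `h` (see `epi_recessionFun`). -/
noncomputable def recessionFun {X : Type*} [AddCommGroup X] [Module ℝ X] (h : X → EReal) :
    X → EReal :=
  fun d => sInf ((fun r : ℝ => (r : EReal)) '' {r : ℝ | (d, r) ∈ recessionCone (epi h)})

theorem epi_recessionFun {X : Type*} [AddCommGroup X] [Module ℝ X] (h : X → EReal) :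
    epi (recessionFun h) = recessionCone (epi h) := by
  ext ⟨d, r⟩
  constructor
  · intro hd
    rintro ⟨x, α⟩ hx s hs
    have key : ∀ ε : ℝ, 0 < ε → h (x + s • d) ≤ ((α + s * (r + ε) : ℝ) : EReal) := by
      intro ε hε
      have hlt : recessionFun h d < ((r + ε : ℝ) : EReal) :=
        lt_of_le_of_lt hd (EReal.coe_lt_coe_iff.mpr (by simpa using hε))
      obtain ⟨_, ⟨r', hr', rfl⟩, hlt'⟩ := sInf_lt_iff.mp hlt
      have h1 : h (x + s • d) ≤ ((α + s * r' : ℝ) : EReal) := by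
        simpa [epi] using hr' (x, α) hx s hs
      have h2 : r' ≤ r + ε := (EReal.coe_lt_coe_iff.mp hlt').le
      exact h1.trans (EReal.coe_le_coe_iff.mpr (by gcongr))
    have goal : h (x + s • d) ≤ ((α + s * r : ℝ) : EReal) := by
      refine EReal.le_of_forall_lt_iff_le.mp ?_
      intro z hz
      have hz' : α + s * r < z := EReal.coe_lt_coe_iff.mp hz
      have hs1 : 0 < s + 1 := by linarith
      refine (key ((z - (α + s * r)) / (s + 1)) (div_pos (by linarith) hs1)).trans
        (EReal.coe_le_coe_iff.mpr ?_)
      have h3 : s * ((z - (α + s * r)) / (s + 1)) ≤ z - (α + s * r) := by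
        rw [mul_div_assoc', div_le_iff₀ hs1]
        nlinarith
      linarith
    simpa [epi] using goal
  · intro hd
    have hmem : (r : EReal) ∈ (fun r : ℝ => (r : EReal)) ''
        {r : ℝ | (d, r) ∈ recessionCone (epi h)} := ⟨r, hd, rfl⟩
    exact sInf_le hmem

/-- `h` is weakly inf-locally compact: each sublevel set `[h ≤ r]`, `r ∈ ℝ`, is locally compact
for the weak topology `σ(X, X*)`. -/
def WeaklyInfLocallyCompact {X : Type*} [AddCommGroup X] [Module ℝ X] [TopologicalSpace X]
    (h : X → EReal) : Prop :=
  ∀ r : ℝ, LocallyCompactSpace ↥(toWeakSpace ℝ X '' {x | h x ≤ (r : EReal)})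

/-- The feasible set `E = ⋂_{t ∈ T} [f_t ≤ 0]`. -/
def feasibleSet {X Z : Type*} (T : Set Z) (g : Z → X → EReal) : Set X :=
  {x | ∀ t ∈ T, g t x ≤ 0}

/-- The recession cone of the problem:
`(P)_∞ = ⋂_{t ∈ T} [(f_t)_∞ ≤ 0] ∩ [f_∞ ≤ 0]`. -/
def problemRecessionCone {X Z : Type*} [AddCommGroup X] [Module ℝ X]
    (f : X → EReal) (T : Set Z) (g : Z → X → EReal) : Set X :=
  {d | (∀ t ∈ T, recessionFun (g t) d ≤ 0) ∧ recessionFun f d ≤ 0}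

/-- The Lagrangian `f + μ f_t`; in `EReal` one has `0 * ⊤ = 0`. -/
noncomputable def lagrangian {X Z : Type*} (f : X → EReal) (g : Z → X → EReal)
    (t : Z) (μ : ℝ≥0) : X → EReal :=
  fun x => f x + ((μ : ℝ) : EReal) * g t x

end ReverseDuality

namespace ReverseDuality

open Set Topology Filter

/-! Let `s` be the dual value. Weak duality gives `s ≤ f` on the feasible set, so it suffices to
find a feasible point with `f ≤ s`. A point common to all Lagrangian sublevel sets at levels `α > s`
close to `s` will do: the multiplier `0` bounds `f`, arbitrarily large multipliers force the
constraints, and `α` decreases to `s`.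

Finitely many such sets always meet (`exists_forall_lagrangian_le`): otherwise finite-dimensional
separation bounds a convex combination of Lagrangians below by the same combination of levels, and
concavity in `t` merges it into one Lagrangian whose infimum exceeds `s`.

Compactness comes from recession (`nonempty_iInter_of_recession_subspace`). The common recession
directions form a subspace, finite-dimensional because a translate of it is closed in a weakly
locally compact sublevel set. Slicing across it leaves no nonzero common direction, and then
finitely many of the sets have compact intersection (`exists_finset_isCompact_biInter`). -/

/-! ### Compactness from recession directions. -/

/-- A family of closed convex sets with a common point and no common direction of recession, one of
which is locally compact, has a compact finite subintersection. -/
theorem exists_finset_isCompact_biInter {V ι : Type*} [AddCommGroup V] [Module ℝ V]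
    [TopologicalSpace V] [IsTopologicalAddGroup V] [ContinuousSMul ℝ V] [T2Space V]
    {B : ι → Set V} (hclosed : ∀ i, IsClosed (B i)) (hconvex : ∀ i, Convex ℝ (B i))
    {x₀ : V} (hx₀ : ∀ i, x₀ ∈ B i) (i₀ : ι) (hloc : LocallyCompactSpace (B i₀))
    (hrec : ∀ d, (∀ i, ∀ n : ℕ, x₀ + (n : ℝ) • d ∈ B i) → d = 0) :
    ∃ F : Finset ι, IsCompact (⋂ i ∈ F, B i) := by
  classical
  obtain ⟨K', hK', hK'n⟩ := exists_compact_mem_nhds (⟨x₀, hx₀ i₀⟩ : B i₀)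
  have hK : IsCompact (((↑) : B i₀ → V) '' K') := hK'.image continuous_subtype_val
  set K : Set V := ((↑) : B i₀ → V) '' K' with hKdef
  obtain ⟨N, hN, hNK⟩ := mem_nhds_subtype _ _ _ |>.1 hK'n
  obtain ⟨W, hWN, hW, hx₀W⟩ := mem_nhds_iff.1 hN
  have hWK : ∀ x ∈ W, x ∈ B i₀ → x ∈ K := fun x hx hxB =>
    ⟨⟨x, hxB⟩, hNK (hWN hx), rfl⟩
  let C : ι × ℕ → Set V := fun p => {x | x₀ + (p.2 : ℝ) • (x - x₀) ∈ B p.1}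
  have hC : ∀ p, IsClosed (C p) := fun p =>
    (hclosed p.1).preimage (by fun_prop)
  -- A point of every `C p` spans a ray from `x₀` inside every `B i`, so it equals `x₀`, which lies
  -- in `W`.
  have hempty : (K \ W) ∩ ⋂ p, C p = ∅ := by
    rw [eq_empty_iff_forall_notMem]
    rintro x ⟨⟨-, hxW⟩, hx⟩
    rw [mem_iInter] at hx
    have := hrec (x - x₀) fun i n => hx (i, n)
    exact hxW (by rwa [sub_eq_zero.1 this])
  obtain ⟨u, hu⟩ := (hK.diff hW).elim_finite_subfamily_closed C hC hempty
  obtain ⟨M, hM⟩ : ∃ M : ℕ, ∀ p ∈ u, p.2 ≤ M := ⟨u.sup Prod.snd, fun p hp => Finset.le_sup hp⟩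
  have hM0 : (0 : ℝ) < M + 1 := by positivity
  refine ⟨insert i₀ (u.image Prod.fst), ?_⟩
  refine (hK.image (f := fun x => x₀ + ((M : ℝ) + 1) • (x - x₀)) (by fun_prop)).of_isClosed_subset
    (isClosed_biInter fun i _ => hclosed i) ?_
  intro y hy
  rw [mem_iInter₂] at hy
  have hyB : ∀ i ∈ insert i₀ (u.image Prod.fst), ∀ τ : ℝ, 0 ≤ τ → τ ≤ 1 →
      x₀ + τ • (y - x₀) ∈ B i := fun i hi τ h0 h1 =>
    (hconvex i).add_smul_sub_mem (hx₀ i) (hy i hi) ⟨h0, h1⟩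
  have hle : (M + 1 : ℝ)⁻¹ ≤ 1 := inv_le_one_of_one_le₀ (by linarith [Nat.cast_nonneg (α := ℝ) M])
  suffices hmem : x₀ + (M + 1 : ℝ)⁻¹ • (y - x₀) ∈ W by
    refine ⟨_, hWK _ hmem (hyB _ (Finset.mem_insert_self _ _) _ (by positivity) hle), ?_⟩
    simp [smul_smul, mul_inv_cancel₀ hM0.ne']
  -- Follow the segment from `x₀` to its first exit `γ τ` from `W`. It is a limit of points of `K`,
  -- and `p.2 * τ ≤ 1` puts it in each `C p` with `p ∈ u`, which is impossible.
  by_contra hnot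
  let γ : ℝ → V := fun τ => x₀ + τ • (y - x₀)
  have hγ : Continuous γ := by fun_prop
  let S : Set ℝ := Icc 0 (M + 1 : ℝ)⁻¹ ∩ γ ⁻¹' Wᶜ
  have hS : IsCompact S := isCompact_Icc.inter_right (hW.isClosed_compl.preimage hγ)
  obtain ⟨τ, hτS, hτ⟩ := hS.exists_isLeast ⟨_, ⟨by positivity, le_rfl⟩, hnot⟩
  have hτ0 : 0 < τ := by
    refine lt_of_le_of_ne hτS.1.1 ?_
    rintro rfl
    exact hτS.2 (by simpa [γ] using hx₀W)
  have hτK : γ τ ∈ K := by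
    have hsub : γ '' Ico 0 τ ⊆ K := by
      rintro _ ⟨σ, hσ, rfl⟩
      refine hWK _ (by_contra fun h => ?_)
        (hyB _ (Finset.mem_insert_self _ _) σ hσ.1 ((hσ.2.le.trans hτS.1.2).trans hle))
      exact absurd (hτ ⟨⟨hσ.1, hσ.2.le.trans hτS.1.2⟩, h⟩) (not_le.2 hσ.2)
    refine closure_minimal hsub hK.isClosed (image_closure_subset_closure_image hγ ?_)
    rw [closure_Ico hτ0.ne]
    exact mem_image_of_mem _ ⟨hτ0.le, le_rfl⟩
  have : γ τ ∈ (K \ W) ∩ ⋂ p ∈ u, C p := by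
    refine ⟨⟨hτK, hτS.2⟩, mem_iInter₂.2 fun p hp => ?_⟩
    have h := hyB p.1 (Finset.mem_insert_of_mem (Finset.mem_image_of_mem _ hp)) (p.2 * τ)
      (by positivity) ?_
    · simpa [C, γ, smul_smul] using h
    · have hpM : (p.2 : ℝ) ≤ M + 1 := by
        have : (p.2 : ℝ) ≤ M := by exact_mod_cast hM p hp
        linarith
      calc (p.2 : ℝ) * τ ≤ (M + 1) * (M + 1 : ℝ)⁻¹ :=
            mul_le_mul hpM hτS.1.2 hτ0.le hM0.le
        _ = 1 := mul_inv_cancel₀ hM0.ne'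
  rw [hu] at this
  exact this

/-- Let `B i` be closed convex sets with a common point, one of them locally compact, whose common
directions of recession form a linear subspace `L`. Then closed `L`-invariant subsets `A i ⊆ B i`
with the finite intersection property have a common point. -/
theorem nonempty_iInter_of_recession_subspace {V ι : Type*} [AddCommGroup V] [Module ℝ V]
    [TopologicalSpace V] [IsTopologicalAddGroup V] [ContinuousSMul ℝ V] [LocallyConvexSpace ℝ V]
    [T2Space V] {A B : ι → Set V} (hclosed : ∀ i, IsClosed (B i)) (hconvex : ∀ i, Convex ℝ (B i))
    {x₀ : V} (hx₀ : ∀ i, x₀ ∈ B i) (i₀ : ι) (hloc : LocallyCompactSpace (B i₀))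
    (L : Submodule ℝ V) (hrec : ∀ d, d ∈ L ↔ ∀ i, ∀ n : ℕ, x₀ + (n : ℝ) • d ∈ B i)
    (hAB : ∀ i, A i ⊆ B i) (hAclosed : ∀ i, IsClosed (A i))
    (hAL : ∀ i, ∀ x ∈ A i, ∀ d ∈ L, x + d ∈ A i)
    (hfip : ∀ F : Finset ι, (⋂ i ∈ F, A i).Nonempty) : (⋂ i, A i).Nonempty := by
  classical
  have hLclosed : IsClosed (L : Set V) := by
    have : (L : Set V) = ⋂ i, ⋂ n : ℕ, (fun d => x₀ + (n : ℝ) • d) ⁻¹' B i := by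
      ext d; simp [hrec]
    rw [this]
    exact isClosed_iInter fun i => isClosed_iInter fun n => (hclosed i).preimage (by fun_prop)
  have hmem : ∀ d : L, x₀ + (d : V) ∈ B i₀ := fun d => by simpa using (hrec d).1 d.2 i₀ 1
  -- As a closed subspace of `B i₀`, the translate `x₀ + L` is locally compact; Riesz's theorem then
  -- makes `L` finite-dimensional.
  let e : L → B i₀ := fun d => ⟨x₀ + d, hmem d⟩
  have he : IsClosedEmbedding e := by
    refine ⟨⟨?_, fun a b hab => ?_⟩, ?_⟩
    · refine IsInducing.of_comp (g := ((↑) : B i₀ → V)) (by fun_prop) continuous_subtype_val ?_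
      exact (Homeomorph.addLeft x₀).isInducing.comp IsInducing.subtypeVal
    · exact Subtype.ext (add_left_cancel (congrArg Subtype.val hab))
    · have : range e = (fun b : B i₀ => (b : V) - x₀) ⁻¹' L := by
        ext b
        constructor
        · rintro ⟨d, rfl⟩; simp [e]
        · intro hb; exact ⟨⟨_, hb⟩, Subtype.ext (by simp [e])⟩
      rw [this]
      exact hLclosed.preimage (by fun_prop)
  have : LocallyCompactSpace L := he.locallyCompactSpace
  have : FiniteDimensional ℝ L := .of_locallyCompactSpace ℝ
  obtain ⟨P, hP⟩ := Submodule.ClosedComplemented.of_finiteDimensional (𝕜 := ℝ) L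
  -- The slice through `x₀` along `ker P`, transverse to `L`; adding it to the family kills all
  -- directions in `L`.
  let H : Set V := {x | P x = P x₀}
  have hH : IsClosed H := isClosed_eq (by fun_prop) (by fun_prop)
  let B' : Option ι → Set V := fun o => o.elim H B
  obtain ⟨F, hF⟩ := exists_finset_isCompact_biInter (B := B') (x₀ := x₀)
    (fun o => by cases o; exacts [hH, hclosed _])
    (fun o => by
      cases o
      · intro x hx y hy a b _ _ hab
        have hx' : P x = P x₀ := hx
        have hy' : P y = P x₀ := hy
        change P (a • x + b • y) = P x₀
        rw [map_add, map_smul, map_smul, hx', hy', ← add_smul, hab, one_smul]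
      · exact hconvex _)
    (fun o => by cases o; exacts [rfl, hx₀ _]) (some i₀) hloc
    (fun d hd => by
      have hdL : d ∈ L := (hrec d).2 fun i n => hd (some i) n
      have h1 : P (x₀ + ((1 : ℕ) : ℝ) • d) = P x₀ := hd none 1
      have h2 : P d = 0 := by simpa using h1
      have h3 := hP ⟨d, hdL⟩
      rw [h2] at h3
      exact (congrArg Subtype.val h3).symm)
  let F' : Finset ι := F.eraseNone
  have hFF : ∀ x ∈ H, (∀ i ∈ F', x ∈ B i) → x ∈ ⋂ o ∈ F, B' o := by
    intro x hxH hx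
    refine mem_iInter₂.2 fun o ho => ?_
    cases o with
    | none => exact hxH
    | some i => exact hx i (Finset.mem_eraseNone.2 ho)
  have key := hF.inter_iInter_nonempty (fun i => A i ∩ H) (fun i => (hAclosed i).inter hH) ?_
  · obtain ⟨x, -, hx⟩ := key
    exact ⟨x, mem_iInter.2 fun i => (mem_iInter.1 hx i).1⟩
  · intro G
    obtain ⟨x, hx⟩ := hfip (G ∪ F')
    rw [mem_iInter₂] at hx
    -- Moving along `L` brings `x` into the slice without leaving the sets `A i`.
    let d : L := P x₀ - P x
    have hdA : ∀ i ∈ G ∪ F', x + d ∈ A i := fun i hi => hAL i x (hx i hi) d d.2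
    have hdH : x + d ∈ H := by
      change P (x + d) = P x₀
      rw [map_add, hP d]
      simp [d]
    exact ⟨x + d, hFF _ hdH fun i hi => hAB i (hdA i (Finset.mem_union_right _ hi)),
      mem_iInter₂.2 fun i hi => ⟨hdA i (Finset.mem_union_left _ hi), hdH⟩⟩

/-! ### Separation and merging of multipliers. -/

/-- If finitely many convex functions on `S` have no common point of nonpositivity, then some convex
combination of them is nonnegative on `S`. -/
theorem exists_stdSimplex_sum_nonneg {V κ : Type*} [AddCommGroup V] [Module ℝ V] [Fintype κ]
    {S : Set V} (hS : S.Nonempty) {φ : κ → V → ℝ} (hφ : ∀ k, ConvexOn ℝ S (φ k))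
    (h : ∀ x ∈ S, ∃ k, 0 < φ k x) :
    ∃ w ∈ stdSimplex ℝ κ, ∀ x ∈ S, 0 ≤ ∑ k, w k * φ k x := by
  classical
  let C : Set (κ → ℝ) := {u | ∃ x ∈ S, ∀ k, φ k x ≤ u k}
  have hC : Convex ℝ C := by
    rintro u ⟨x, hx, hu⟩ v ⟨y, hy, hv⟩ a b ha hb hab
    obtain ⟨x', hx'⟩ := hS
    have hconv : Convex ℝ S := by
      obtain ⟨k, -⟩ := h x' hx'
      exact (hφ k).1
    refine ⟨a • x + b • y, hconv hx hy ha hb hab, fun k => ?_⟩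
    refine ((hφ k).2 hx hy ha hb hab).trans ?_
    simp only [smul_eq_mul, Pi.add_apply, Pi.smul_apply]
    exact add_le_add (mul_le_mul_of_nonneg_left (hu k) ha) (mul_le_mul_of_nonneg_left (hv k) hb)
  let U : Set (κ → ℝ) := univ.pi fun _ => Iio 0
  have hU : IsOpen U := isOpen_set_pi finite_univ fun _ _ => isOpen_Iio
  have hUc : Convex ℝ U := convex_pi fun _ _ => convex_Iio 0
  have hdisj : Disjoint U C := by
    rw [Set.disjoint_left]
    rintro u hu ⟨x, hx, hxu⟩
    obtain ⟨k, hk⟩ := h x hx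
    exact absurd ((hk.trans_le (hxu k)).trans (hu k trivial)) (lt_irrefl _)
  obtain ⟨ℓ, c, hℓU, hℓC⟩ := geometric_hahn_banach_open hUc hU hC hdisj
  let v : κ → ℝ := fun k => ℓ (Pi.single k 1)
  have hℓ : ∀ u : κ → ℝ, ℓ u = ∑ k, v k * u k := by
    intro u
    conv_lhs => rw [pi_eq_sum_univ' u]
    rw [map_sum]
    refine Finset.sum_congr rfl fun k _ => ?_
    simp [v, mul_comm]
  -- The origin is a limit of points of `U`.
  have hc : 0 ≤ c := by
    by_contra! hc
    have ht : Tendsto (fun ε : ℝ => ℓ (fun _ => -ε)) (𝓝[>] 0) (𝓝 0) := by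
      have : Continuous fun ε : ℝ => ℓ (fun _ => -ε) := by fun_prop
      have h0 := this.tendsto 0
      have hz : ℓ (fun _ => -(0:ℝ)) = 0 := by
        rw [hℓ]; simp
      rw [hz] at h0
      exact h0.mono_left nhdsWithin_le_nhds
    have hle : ∀ᶠ ε : ℝ in 𝓝[>] 0, ℓ (fun _ => -ε) ≤ c := by
      filter_upwards [self_mem_nhdsWithin] with ε hε
      exact (hℓU _ fun k _ => by simpa using hε).le
    exact absurd (le_of_tendsto ht hle) (not_le.2 hc)
  -- `C` is stable under increasing any coordinate, while `ℓ` is bounded below on it.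
  have hv : ∀ k, 0 ≤ v k := by
    intro k
    by_contra! hk
    obtain ⟨x, hx⟩ := hS
    have hmem : ∀ n : ℕ, (fun j => φ j x) + (n : ℝ) • Pi.single k (1 : ℝ) ∈ C := fun n =>
      ⟨x, hx, fun j => by
        have : 0 ≤ (Pi.single k (1:ℝ) : κ → ℝ) j := by
          rw [Pi.single_apply]; split_ifs <;> norm_num
        simp only [Pi.add_apply, Pi.smul_apply, smul_eq_mul]
        have := mul_nonneg (Nat.cast_nonneg (α := ℝ) n) this
        linarith⟩
    obtain ⟨n, hn⟩ := exists_nat_gt ((ℓ (fun j => φ j x)) / (-v k))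
    have h1 := hℓC _ (hmem n)
    rw [map_add, map_smul, smul_eq_mul] at h1
    rw [div_lt_iff₀ (by linarith)] at hn
    change c ≤ _ + n * v k at h1
    linarith
  have hpos : 0 < ∑ k, v k := by
    have h1 := hℓU (fun _ => -1) fun _ _ => by simp
    obtain ⟨x, hx⟩ := hS
    have hne : ∃ k, v k ≠ 0 := by
      by_contra! hall
      have h2 := hℓC _ ⟨x, hx, fun k => le_refl (φ k x)⟩
      rw [hℓ] at h1 h2
      simp [hall] at h1 h2
      linarith
    obtain ⟨k, hk⟩ := hne
    exact Finset.sum_pos' (fun j _ => hv j) ⟨k, Finset.mem_univ _, lt_of_le_of_ne (hv k) hk.symm⟩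
  refine ⟨fun k => v k / ∑ j, v j, ⟨fun k => div_nonneg (hv k) hpos.le, ?_⟩, fun x hx => ?_⟩
  · rw [← Finset.sum_div, div_self hpos.ne']
  · have h2 := hc.trans (hℓC _ ⟨x, hx, fun k => le_refl (φ k x)⟩)
    rw [hℓ] at h2
    have : ∑ k, v k / (∑ j, v j) * φ k x = (∑ k, v k * φ k x) / ∑ j, v j := by
      rw [Finset.sum_div]
      exact Finset.sum_congr rfl fun k _ => by ring
    rw [this]
    exact div_nonneg h2 hpos.le

/-- A nonnegative combination of functions that are concave in a parameter is dominated by a multiple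
of a single one of them. -/
theorem exists_sum_mul_le_of_concaveOn {X Z : Type*} [AddCommGroup Z] [Module ℝ Z]
    {T : Set Z} (hT : Convex ℝ T) (hTne : T.Nonempty)
    {S : Set X} {G : Z → X → ℝ} (hG : ∀ x ∈ S, ConcaveOn ℝ T fun t => G t x)
    {κ : Type*} [Fintype κ] {w : κ → ℝ} (hw : ∀ k, 0 ≤ w k) (t : κ → Z) (ht : ∀ k, t k ∈ T) :
    ∃ t' ∈ T, ∀ x ∈ S, ∑ k, w k * G (t k) x ≤ (∑ k, w k) * G t' x := by
  have hsum : 0 ≤ ∑ k, w k := Finset.sum_nonneg fun k _ => hw k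
  rcases hsum.eq_or_lt with h0 | hpos
  · obtain ⟨t', ht'⟩ := hTne
    refine ⟨t', ht', fun x _ => ?_⟩
    have hz : ∀ k, w k = 0 := fun k =>
      (Finset.sum_eq_zero_iff_of_nonneg fun k _ => hw k).1 h0.symm k (Finset.mem_univ k)
    simp [hz]
  · have h1 : ∑ k, w k / ∑ j, w j = 1 := by rw [← Finset.sum_div, div_self hpos.ne']
    have h2 : ∀ k ∈ Finset.univ, 0 ≤ w k / ∑ j, w j := fun k _ => div_nonneg (hw k) hpos.le
    -- The barycentre of the parameters works by Jensen's inequality.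
    refine ⟨∑ k, (w k / ∑ j, w j) • t k, hT.sum_mem h2 h1 fun k _ => ht k, fun x hx => ?_⟩
    have h3 := (hG x hx).le_map_sum h2 h1 fun k _ => ht k
    have h4 := mul_le_mul_of_nonneg_left h3 hpos.le
    refine le_trans (le_of_eq ?_) h4
    rw [Finset.mul_sum]
    refine Finset.sum_congr rfl fun k _ => ?_
    rw [smul_eq_mul]
    field_simp

/-! ### Recession and real values of functions in `Γ(X)`. -/

theorem recessionFun_nonpos_iff {X : Type*} [AddCommGroup X] [Module ℝ X] {h : X → EReal} {d : X} :
    recessionFun h d ≤ 0 ↔ (d, (0 : ℝ)) ∈ recessionCone (epi h) := by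
  rw [← epi_recessionFun]
  simp [epi]

section Gamma

variable {X : Type*} [AddCommGroup X] [Module ℝ X] [TopologicalSpace X] {h : X → EReal}

theorem IsGamma.ne_bot (hh : IsGamma h) (x : X) : h x ≠ ⊥ := hh.proper.2 x

theorem IsGamma.coe_toReal (hh : IsGamma h) {x : X} (hx : x ∈ effDom h) :
    ((h x).toReal : EReal) = h x :=
  EReal.coe_toReal (ne_of_lt hx) (hh.ne_bot x)

theorem IsGamma.mem_epi_toReal (hh : IsGamma h) {x : X} (hx : x ∈ effDom h) :
    (x, (h x).toReal) ∈ epi h := (hh.coe_toReal hx).ge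

theorem IsGamma.convexOn_toReal (hh : IsGamma h) {S : Set X} (hS : Convex ℝ S)
    (hSh : S ⊆ effDom h) : ConvexOn ℝ S fun x => (h x).toReal := by
  refine ⟨hS, fun x hx y hy a b ha hb hab => ?_⟩
  have h1 : h (a • x + b • y) ≤ ((a * (h x).toReal + b * (h y).toReal : ℝ) : EReal) := by
    simpa [epi] using hh.convex (hh.mem_epi_toReal (hSh hx)) (hh.mem_epi_toReal (hSh hy)) ha hb hab
  rw [← hh.coe_toReal (hSh (hS hx hy ha hb hab)), EReal.coe_le_coe_iff] at h1
  exact h1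

theorem IsGamma.convex_effDom (hh : IsGamma h) : Convex ℝ (effDom h) := by
  intro x hx y hy a b ha hb hab
  have h1 : h (a • x + b • y) ≤ ((a * (h x).toReal + b * (h y).toReal : ℝ) : EReal) := by
    simpa [epi] using hh.convex (hh.mem_epi_toReal hx) (hh.mem_epi_toReal hy) ha hb hab
  exact h1.trans_lt (EReal.coe_lt_top _)

theorem IsGamma.isClosed_epi (hh : IsGamma h) : IsClosed (epi h) :=
  hh.lsc.isClosed_epigraph.preimage
    (continuous_fst.prodMk (continuous_coe_real_ereal.comp continuous_snd))

/-- A direction along which a closed convex set contains one half-line is a direction of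
recession. -/
theorem mem_recessionCone_of_ray {V : Type*} [AddCommGroup V] [Module ℝ V] [TopologicalSpace V]
    [ContinuousAdd V] [ContinuousSMul ℝ V] {A : Set V} (hA : IsClosed A)
    (hconv : Convex ℝ A) {a d : V} (hd : ∀ n : ℕ, a + (n : ℝ) • d ∈ A) : d ∈ recessionCone A := by
  intro b hb s hs
  -- These are convex combinations of `b` and `a + n • d` with weight `s / (n + 1)` on the latter;
  -- they tend to `b + s • d`.
  have hlim : Tendsto (fun n : ℕ => (1 - s / (n + 1 : ℝ)) • b + (s / (n + 1 : ℝ)) • a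
      + (s * (n / (n + 1 : ℝ))) • d) atTop (𝓝 ((1 - 0 : ℝ) • b + (0 : ℝ) • a + (s * 1) • d)) := by
    have h0 : Tendsto (fun n : ℕ => s / (n + 1 : ℝ)) atTop (𝓝 0) :=
      tendsto_const_nhds.div_atTop
        (tendsto_atTop_add_const_right _ _ tendsto_natCast_atTop_atTop)
    have h1 : Tendsto (fun n : ℕ => (n / (n + 1 : ℝ))) atTop (𝓝 1) :=
      tendsto_natCast_div_add_atTop 1
    exact (((tendsto_const_nhds.sub h0).smul_const b).add (h0.smul_const a)).add
      ((h1.const_mul s).smul_const d)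
  have hmem : ∀ᶠ n : ℕ in atTop, (1 - s / (n + 1 : ℝ)) • b + (s / (n + 1 : ℝ)) • a
      + (s * (n / (n + 1 : ℝ))) • d ∈ A := by
    obtain ⟨M, hM⟩ := exists_nat_gt s
    filter_upwards [eventually_ge_atTop M] with n hn
    have hn0 : (0 : ℝ) < n + 1 := by positivity
    have hsn : s / (n + 1 : ℝ) ≤ 1 := by
      rw [div_le_one hn0]
      have : (M : ℝ) ≤ n := by exact_mod_cast hn
      linarith
    have := hconv hb (hd n) (sub_nonneg.2 hsn) (div_nonneg hs hn0.le) (by ring)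
    rw [smul_add, smul_smul, ← add_assoc] at this
    convert this using 3
    ring
  simpa using hA.mem_of_tendsto hlim hmem

theorem IsGamma.le_of_recessionFun_nonpos (hh : IsGamma h) {d : X} (hd : recessionFun h d ≤ 0)
    (x : X) {s : ℝ} (hs : 0 ≤ s) : h (x + s • d) ≤ h x := by
  by_cases hx : x ∈ effDom h
  · have := recessionFun_nonpos_iff.1 hd _ (hh.mem_epi_toReal hx) s hs
    rw [← hh.coe_toReal hx]
    simpa [epi] using this
  · rw [show h x = ⊤ from not_lt_top_iff.1 hx]
    exact le_top

theorem IsGamma.recessionFun_nonpos_of_ray [ContinuousAdd X] [ContinuousSMul ℝ X]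
    (hh : IsGamma h) {x d : X} {α : ℝ} (hd : ∀ n : ℕ, h (x + (n : ℝ) • d) ≤ α) :
    recessionFun h d ≤ 0 := by
  refine recessionFun_nonpos_iff.2
    (mem_recessionCone_of_ray hh.isClosed_epi hh.convex (a := (x, α)) fun n => ?_)
  simpa [epi] using hd n

end Gamma

/-! ### Lagrangians and the finite intersection property. -/

section Lagrangian

variable {X Z : Type*} [AddCommGroup X] [Module ℝ X] [TopologicalSpace X]
  {f : X → EReal} {g : Z → X → EReal} {t : Z} {μ : ℝ≥0}

theorem coe_mul_ne_bot (hgt : IsGamma (g t)) (x : X) : ((μ : ℝ) : EReal) * g t x ≠ ⊥ := by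
  rw [EReal.mul_ne_bot]
  refine ⟨Or.inl (EReal.coe_ne_bot _), Or.inr (hgt.ne_bot x), Or.inl (EReal.coe_ne_top _),
    Or.inl (by exact_mod_cast μ.2)⟩

/-- The multiplier term is never `⊥`, so it cannot absorb `f x = ⊤`. -/
theorem lagrangian_eq_top (hgt : IsGamma (g t)) {x : X} (hx : x ∉ effDom f) :
    lagrangian f g t μ x = ⊤ := by
  rw [lagrangian, show f x = ⊤ from not_lt_top_iff.1 hx]
  exact EReal.top_add_of_ne_bot (coe_mul_ne_bot hgt x)

theorem lagrangian_eq_coe (hf : IsGamma f) (hgt : IsGamma (g t)) (hdom : effDom f ⊆ effDom (g t))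
    {x : X} (hx : x ∈ effDom f) :
    lagrangian f g t μ x = (((f x).toReal + μ * (g t x).toReal : ℝ) : EReal) := by
  rw [lagrangian, ← hf.coe_toReal hx, ← hgt.coe_toReal (hdom hx)]
  simp

theorem setOf_lagrangian_le (hf : IsGamma f) (hgt : IsGamma (g t))
    (hdom : effDom f ⊆ effDom (g t)) (α : ℝ) :
    {x | lagrangian f g t μ x ≤ (α : EReal)} =
      {x ∈ effDom f | (f x).toReal + μ * (g t x).toReal ≤ α} := by
  ext x
  by_cases hx : x ∈ effDom f
  · simp only [mem_ofPred_eq, lagrangian_eq_coe hf hgt hdom hx, EReal.coe_le_coe_iff, hx, true_and]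
  · simp [lagrangian_eq_top hgt hx, hx]

theorem convexOn_lagrangian (hf : IsGamma f) (hgt : IsGamma (g t))
    (hdom : effDom f ⊆ effDom (g t)) :
    ConvexOn ℝ (effDom f) fun x => (f x).toReal + (μ : ℝ) * (g t x).toReal :=
  (hf.convexOn_toReal hf.convex_effDom subset_rfl).add
    ((hgt.convexOn_toReal hf.convex_effDom hdom).smul μ.2)

theorem convex_lagrangian_le (hf : IsGamma f) (hgt : IsGamma (g t))
    (hdom : effDom f ⊆ effDom (g t)) (α : ℝ) :
    Convex ℝ {x | lagrangian f g t μ x ≤ (α : EReal)} := by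
  rw [setOf_lagrangian_le hf hgt hdom]
  exact (convexOn_lagrangian hf hgt hdom).convex_le α

theorem lowerSemicontinuous_lagrangian (hf : IsGamma f) (hgt : IsGamma (g t)) :
    LowerSemicontinuous (lagrangian f g t μ) := by
  have hmul : LowerSemicontinuous fun x => ((μ : ℝ) : EReal) * g t x := by
    rcases eq_or_ne μ 0 with rfl | hμ
    · simpa using lowerSemicontinuous_const
    · have hcont : Continuous fun y : EReal => ((μ : ℝ) : EReal) * y := by
        refine continuous_iff_continuousAt.2 fun y => ?_
        have hμ' : ((μ : ℝ) : EReal) ≠ 0 := by simpa using hμ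
        exact EReal.Tendsto.mul tendsto_const_nhds tendsto_id (Or.inl hμ') (Or.inl hμ')
          (Or.inl (EReal.coe_ne_bot _)) (Or.inl (EReal.coe_ne_top _))
      exact hcont.comp_lowerSemicontinuous hgt.lsc
        fun a b hab => mul_le_mul_of_nonneg_left hab (by exact_mod_cast μ.2)
  refine hf.lsc.add' hmul fun x => ?_
  exact EReal.continuousAt_add (Or.inr (coe_mul_ne_bot hgt x)) (Or.inl (hf.ne_bot x))

theorem lagrangian_add_smul_le (hf : IsGamma f) (hgt : IsGamma (g t)) {d : X}
    (hdf : recessionFun f d ≤ 0) (hdg : recessionFun (g t) d ≤ 0) (x : X) {s : ℝ} (hs : 0 ≤ s) :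
    lagrangian f g t μ (x + s • d) ≤ lagrangian f g t μ x :=
  add_le_add (hf.le_of_recessionFun_nonpos hdf x hs)
    (mul_le_mul_of_nonneg_left (hgt.le_of_recessionFun_nonpos hdg x hs) (by exact_mod_cast μ.2))

/-- The Lagrangian is bounded by `α` for all multipliers only at points where `f ≤ α` and the
constraint holds. -/
theorem le_and_nonpos_of_lagrangian_le (hf : IsGamma f) (hgt : IsGamma (g t))
    (hdom : effDom f ⊆ effDom (g t)) {x : X} {α : ℝ}
    (h : ∀ μ : ℝ≥0, lagrangian f g t μ x ≤ α) : f x ≤ α ∧ g t x ≤ 0 := by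
  have h0 : f x ≤ α := by simpa [lagrangian] using h 0
  have hx : x ∈ effDom f := h0.trans_lt (EReal.coe_lt_top _)
  refine ⟨h0, ?_⟩
  rw [← hgt.coe_toReal (hdom hx)]
  by_contra! hpos
  have hpos' : 0 < (g t x).toReal := by exact_mod_cast hpos
  obtain ⟨n, hn⟩ := exists_nat_gt ((α - (f x).toReal) / (g t x).toReal)
  have h1 := h (n : ℝ≥0)
  rw [lagrangian_eq_coe hf hgt hdom hx, EReal.coe_le_coe_iff] at h1
  rw [div_lt_iff₀ hpos'] at hn
  have : (((n : ℝ≥0) : ℝ)) = n := by simp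
  rw [this] at h1
  linarith

variable [AddCommGroup Z] [Module ℝ Z]

theorem IsConcaveOn.concaveOn_toReal {T : Set Z} {φ : Z → EReal} (hφ : IsConcaveOn T φ)
    (hT : Convex ℝ T) (hfin : ∀ t ∈ T, ((φ t).toReal : EReal) = φ t) :
    ConcaveOn ℝ T fun t => (φ t).toReal := by
  refine ⟨hT, fun x hx y hy a b ha hb hab => ?_⟩
  have h1 := (hφ (x := (x, (φ x).toReal)) ⟨hx, (hfin x hx).le⟩
    (y := (y, (φ y).toReal)) ⟨hy, (hfin y hy).le⟩ ha hb hab).2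
  have h2 := hfin _ (hT hx hy ha hb hab)
  simp only [Prod.smul_mk, Prod.mk_add_mk] at h1
  rw [← h2, EReal.coe_le_coe_iff] at h1
  exact h1

/-- Above the value of the Lagrangian dual, finitely many sublevel sets of Lagrangians always
intersect. -/
theorem exists_forall_lagrangian_le {T : Set Z} (hf : IsGamma f) (hg : ∀ t ∈ T, IsGamma (g t))
    (hfne : (effDom f).Nonempty) (hdom : ∀ t ∈ T, effDom f ⊆ effDom (g t)) (hT : Convex ℝ T)
    (hTne : T.Nonempty) (hconc : ∀ x ∈ effDom f, IsConcaveOn T fun t => g t x) {s : EReal}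
    (hs : ∀ t ∈ T, ∀ μ : ℝ≥0, ⨅ x, lagrangian f g t μ x ≤ s) {κ : Type*} [Fintype κ]
    (t : κ → Z) (ht : ∀ k, t k ∈ T) (μ : κ → ℝ≥0) (α : κ → ℝ) (hα : ∀ k, s < α k) :
    ∃ x, ∀ k, lagrangian f g (t k) (μ k) x ≤ α k := by
  by_contra! hcon
  obtain ⟨w, hw, hwφ⟩ := exists_stdSimplex_sum_nonneg hfne
    (φ := fun k x => (f x).toReal + (μ k : ℝ) * (g (t k) x).toReal + -α k)
    (fun k => (convexOn_lagrangian hf (hg _ (ht k)) (hdom _ (ht k))).add_const _)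
    (fun x hx => by
      obtain ⟨k, hk⟩ := hcon x
      rw [lagrangian_eq_coe hf (hg _ (ht k)) (hdom _ (ht k)) hx, EReal.coe_lt_coe_iff] at hk
      exact ⟨k, by linarith⟩)
  obtain ⟨t', ht', hle⟩ := exists_sum_mul_le_of_concaveOn hT hTne (S := effDom f)
    (G := fun t x => (g t x).toReal) (w := fun k => w k * μ k)
    (fun x hx => (hconc x hx).concaveOn_toReal hT fun t ht => (hg t ht).coe_toReal (hdom t ht hx))
    (fun k => mul_nonneg (hw.1 k) (μ k).2) t ht
  -- The weights sum to one, so `f` keeps coefficient `1` and the merged expression is again a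
  -- Lagrangian, with multiplier `ν`.
  let ν : ℝ≥0 := ⟨∑ k, w k * μ k, Finset.sum_nonneg fun k _ => mul_nonneg (hw.1 k) (μ k).2⟩
  have hord : Convex ℝ {a : ℝ | s < a} := by
    refine OrdConnected.convex ⟨fun a ha b _ c hc => ?_⟩
    exact lt_of_lt_of_le ha (EReal.coe_le_coe_iff.2 hc.1)
  have hlt : s < ((∑ k, w k • α k : ℝ) : EReal) :=
    hord.sum_mem (fun k _ => hw.1 k) hw.2 fun k _ => hα k
  refine absurd (hs t' ht' ν) (not_le.2 (hlt.trans_le (le_iInf fun x => ?_)))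
  by_cases hx : x ∈ effDom f
  · rw [lagrangian_eq_coe hf (hg _ ht') (hdom _ ht') hx, EReal.coe_le_coe_iff]
    have h1 := hwφ x hx
    have h2 := hle x hx
    have h3 : ∑ k, w k * ((f x).toReal + (μ k : ℝ) * (g (t k) x).toReal + -α k) =
        (∑ k, w k) * (f x).toReal + ∑ k, w k * μ k * (g (t k) x).toReal - ∑ k, w k • α k := by
      rw [Finset.sum_mul, ← Finset.sum_add_distrib, ← Finset.sum_sub_distrib]
      exact Finset.sum_congr rfl fun k _ => by rw [smul_eq_mul]; ring
    rw [h3, hw.2] at h1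
    change _ ≤ _ + (∑ k, w k * μ k) * _
    linarith
  · rw [lagrangian_eq_top (hg _ ht') hx]
    exact le_top

end Lagrangian

/-! ### Weak closedness and the duality theorem. -/

theorem isClosed_image_toWeakSpace {X : Type*} [AddCommGroup X] [Module ℝ X] [TopologicalSpace X]
    [IsTopologicalAddGroup X] [ContinuousSMul ℝ X] [LocallyConvexSpace ℝ X] {C : Set X}
    (hC : Convex ℝ C) (hclosed : IsClosed C) : IsClosed (toWeakSpace ℝ X '' C) := by
  have h := hC.toWeakSpace_closure ℝ
  rw [hclosed.closure_eq] at h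
  rw [h]
  exact isClosed_closure

end ReverseDuality

open ReverseDuality Set in
theorem corollary5
    {X : Type*} [AddCommGroup X] [Module ℝ X] [TopologicalSpace X] [IsTopologicalAddGroup X]
    [ContinuousSMul ℝ X] [LocallyConvexSpace ℝ X] [T2Space X]
    {Z : Type*} [AddCommGroup Z] [Module ℝ Z] [TopologicalSpace Z] [IsTopologicalAddGroup Z]
    [ContinuousSMul ℝ Z] [LocallyConvexSpace ℝ Z]
    (T : Set Z) (f : X → EReal) (g : Z → X → EReal)
    (hf : ReverseDuality.IsGamma f)
    (hg : ∀ t ∈ T, ReverseDuality.IsGamma (g t))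
    (hE : (ReverseDuality.feasibleSet T g ∩ ReverseDuality.effDom f).Nonempty)
    (ha : ReverseDuality.effDom f ⊆ ⋂ t ∈ T, ReverseDuality.effDom (g t))
    (hb_convex : Convex ℝ T) (hb_compact : IsCompact T)
    (hc_concave : ∀ x ∈ ⋂ t ∈ T, ReverseDuality.effDom (g t),
      ReverseDuality.IsConcaveOn T (fun t => g t x))
    (hc_usc : ∀ x ∈ ⋂ t ∈ T, ReverseDuality.effDom (g t),
      UpperSemicontinuousOn (fun t => g t x) T)
    (hd : ∃ t ∈ T, ∃ μ : ℝ≥0,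
      ReverseDuality.WeaklyInfLocallyCompact (ReverseDuality.lagrangian f g t μ))
    (he : ∃ L : Submodule ℝ X, (L : Set X) = ReverseDuality.problemRecessionCone f T g) :
    ∃ r : ℝ,
      IsLeast (f '' ReverseDuality.feasibleSet T g) (r : EReal) ∧
      (⨆ p : T × ℝ≥0, ⨅ x : X, ReverseDuality.lagrangian f g p.1 p.2 x) = (r : EReal) := by
  obtain ⟨x₀, hx₀E, hx₀f⟩ := hE
  obtain ⟨t₀, ht₀, μ₀, hloc⟩ := hd
  obtain ⟨L, hL⟩ := he
  have hdom : ∀ t ∈ T, effDom f ⊆ effDom (g t) := fun t ht x hx => mem_iInter₂.1 (ha hx) t ht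
  set s : EReal := ⨆ p : T × ℝ≥0, ⨅ x : X, lagrangian f g p.1 p.2 x with hs
  have hle_s : ∀ t ∈ T, ∀ μ : ℝ≥0, ⨅ x, lagrangian f g t μ x ≤ s := fun t ht μ =>
    le_iSup (fun p : T × ℝ≥0 => ⨅ x : X, lagrangian f g p.1 p.2 x) (⟨t, ht⟩, μ)
  have hweak : ∀ x ∈ feasibleSet T g, ∀ t ∈ T, ∀ μ : ℝ≥0, lagrangian f g t μ x ≤ f x := by
    intro x hx t ht μ
    have h1 : ((μ : ℝ) : EReal) * g t x ≤ 0 :=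
      EReal.mul_nonpos_iff.2 (Or.inl ⟨by exact_mod_cast μ.2, hx t ht⟩)
    simpa [lagrangian] using add_le_add_right h1 (f x)
  have hs_le : ∀ x ∈ feasibleSet T g, s ≤ f x := fun x hx =>
    iSup_le fun p => (iInf_le _ x).trans (hweak x hx p.1 p.1.2 p.2)
  obtain ⟨β, hβ, -⟩ := EReal.lt_iff_exists_real_btwn.1 hx₀f
  -- Capping levels at `β > f x₀` gives `A i ⊆ B i` with `x₀` in every `B i`; `s` may still be `⊥`
  -- here.
  let ι : Type _ := {α : ℝ // s < α ∧ α ≤ β} × T × ℝ≥0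
  have hsβ : s < β := (hs_le x₀ hx₀E).trans_lt hβ
  let A : ι → Set (WeakSpace ℝ X) := fun i =>
    toWeakSpace ℝ X '' {x | lagrangian f g i.2.1 i.2.2 x ≤ ((i.1 : ℝ) : EReal)}
  let B : ι → Set (WeakSpace ℝ X) := fun i =>
    toWeakSpace ℝ X '' {x | lagrangian f g i.2.1 i.2.2 x ≤ (β : EReal)}
  have hmemA : ∀ i x, toWeakSpace ℝ X x ∈ A i ↔
      lagrangian f g i.2.1 i.2.2 x ≤ ((i.1 : ℝ) : EReal) := fun i x =>
    (toWeakSpace ℝ X).injective.mem_set_image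
  have hmemB : ∀ i x, toWeakSpace ℝ X x ∈ B i ↔ lagrangian f g i.2.1 i.2.2 x ≤ (β : EReal) :=
    fun i x => (toWeakSpace ℝ X).injective.mem_set_image
  have hclosed : ∀ t ∈ T, ∀ (μ : ℝ≥0) (α : ℝ),
      IsClosed (toWeakSpace ℝ X '' {x | lagrangian f g t μ x ≤ (α : EReal)}) := fun t ht μ α =>
    isClosed_image_toWeakSpace (convex_lagrangian_le hf (hg t ht) (hdom t ht) α)
      ((lowerSemicontinuous_lagrangian hf (hg t ht)).isClosed_preimage _)
  have : LocallyConvexSpace ℝ (WeakSpace ℝ X) :=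
    WeakBilin.locallyConvexSpace (B := (topDualPairing ℝ X).flip)
  have key : (⋂ i, A i).Nonempty := by
    refine nonempty_iInter_of_recession_subspace (B := B) (x₀ := toWeakSpace ℝ X x₀)
      (fun i => hclosed _ i.2.1.2 _ _)
      (fun i => (convex_lagrangian_le hf (hg _ i.2.1.2) (hdom _ i.2.1.2) β).linear_image
        (toWeakSpace ℝ X).toLinearMap)
      (fun i => (hmemB i x₀).2 ((hweak x₀ hx₀E _ i.2.1.2 _).trans hβ.le))
      (⟨β, hsβ, le_rfl⟩, ⟨t₀, ht₀⟩, μ₀) (hloc β)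
      (L.map (toWeakSpace ℝ X).toLinearMap) ?_ ?_ (fun i => hclosed _ i.2.1.2 _ _) ?_ ?_
    · intro d
      obtain ⟨d, rfl⟩ := (toWeakSpace ℝ X).surjective d
      have h1 : toWeakSpace ℝ X d ∈ L.map (toWeakSpace ℝ X).toLinearMap ↔
          d ∈ problemRecessionCone f T g := by
        rw [← hL]
        exact (toWeakSpace ℝ X).injective.mem_set_image
      rw [h1]
      simp only [← map_smul, ← map_add, hmemB]
      constructor
      · intro hd i n
        exact (lagrangian_add_smul_le hf (hg _ i.2.1.2) hd.2 (hd.1 _ i.2.1.2) x₀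
          n.cast_nonneg).trans ((hweak x₀ hx₀E _ i.2.1.2 _).trans hβ.le)
      · intro hd
        have h2 : ∀ t ∈ T, ∀ n : ℕ, f (x₀ + (n : ℝ) • d) ≤ β ∧ g t (x₀ + (n : ℝ) • d) ≤ 0 :=
          fun t ht n => le_and_nonpos_of_lagrangian_le hf (hg t ht) (hdom t ht) fun μ =>
            hd (⟨β, hsβ, le_rfl⟩, ⟨t, ht⟩, μ) n
        exact ⟨fun t ht => (hg t ht).recessionFun_nonpos_of_ray (α := 0) fun n => (h2 t ht n).2,
          hf.recessionFun_nonpos_of_ray fun n => (h2 t₀ ht₀ n).1⟩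
    · exact fun i => image_mono fun x hx =>
        le_trans (mem_ofPred.1 hx) (EReal.coe_le_coe_iff.2 i.1.2.2)
    · rintro i _ ⟨x, hx, rfl⟩ _ ⟨d, hd, rfl⟩
      have hd' : d ∈ problemRecessionCone f T g := hL ▸ hd
      refine (hmemA i (x + d)).2 ?_
      simpa using (lagrangian_add_smul_le hf (hg _ i.2.1.2) hd'.2 (hd'.1 _ i.2.1.2) x
        zero_le_one).trans hx
    · intro F
      obtain ⟨x, hx⟩ := exists_forall_lagrangian_le hf hg ⟨x₀, hx₀f⟩ hdom hb_convex ⟨t₀, ht₀⟩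
        (fun x hx => hc_concave x (ha hx)) hle_s (κ := F) (fun i => i.1.2.1)
        (fun i => i.1.2.1.2) (fun i => i.1.2.2) (fun i => i.1.1) (fun i => i.1.1.2.1)
      exact ⟨toWeakSpace ℝ X x, mem_iInter₂.2 fun i hi => (hmemA i x).2 (hx ⟨i, hi⟩)⟩
  obtain ⟨y, hy⟩ := key
  obtain ⟨x, rfl⟩ := (toWeakSpace ℝ X).surjective y
  rw [mem_iInter] at hy
  have hfg : ∀ α : ℝ, s < α → α ≤ β → ∀ t ∈ T, f x ≤ α ∧ g t x ≤ 0 := fun α h1 h2 t ht =>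
    le_and_nonpos_of_lagrangian_le hf (hg t ht) (hdom t ht) fun μ =>
      (hmemA _ x).1 (hy (⟨α, h1, h2⟩, ⟨t, ht⟩, μ))
  have hxE : x ∈ feasibleSet T g := fun t ht => (hfg β hsβ le_rfl t ht).2
  have hfs : f x = s := by
    refine le_antisymm (EReal.le_of_forall_lt_iff_le.1 fun α hα => ?_) (hs_le x hxE)
    have h3 : s < ((min α β : ℝ) : EReal) := by
      rcases min_choice α β with h | h <;> rw [h] <;> assumption
    exact (hfg _ h3 (min_le_right _ _) t₀ ht₀).1.trans (EReal.coe_le_coe_iff.2 (min_le_left _ _))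
  have hxf : x ∈ effDom f := by
    change f x < ⊤
    exact hfs ▸ hsβ.trans (EReal.coe_lt_top β)
  -- The value is real: `s = f x` lies below `β`, and `f` is never `⊥`.
  refine ⟨(f x).toReal, ?_, ?_⟩
  · rw [hf.coe_toReal hxf]
    refine ⟨mem_image_of_mem f hxE, ?_⟩
    rintro _ ⟨y, hy, rfl⟩
    exact hfs ▸ hs_le y hy
  · rw [hf.coe_toReal hxf, hfs]
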